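/- For $q\ge 1$ let $\mathcal L_{q+1}=\{y\in\mathbb R^{q+1}: y_{q+1}\ge (y_1^2+\dots+y_q^2)^{1/2}\}$. A subset of $\mathbb R^d$ is called SOC representable if it is the projection onto the $x$-coordinates of a set $\{(x,u)\in\mathbb R^d\times\mathbb R^n: (\ell_{i1}(x,u),\ell_{i2}(x,u),\ell_{i3}(x,u))\in\mathcal L_3,\ i=1,\dots,m\}$ for some $n,m\ge 0$ and affine functions $\ell_{ij}$. Let $M>1$, $\mathcal R=[1/M,M]$, $D=[1/M^2,M^2]$, and for $\alpha\in\mathbb R$ let $$K_{\exp}(\alpha)=\{x\in\mathcal R^2\times\mathbb R:\ \log(x_1/x_2)\ge x_3/x_2-\alpha\}.$$ Let $\phi:[-1,1]\times D\to\mathbb R$ be a generating function for the logarithm, with constant $c\in\mathbb R$: for every $t\in[-1,1]$ the function $\phi(t,\cdot)$ is concave and continuous on $D$ and its hypograph $\operatorname{hyp}\phi(t)=\{(x,v): x\in D,\ \phi(t,x)\ge v\}$ is SOC representable; and for every $x\in D$ the function $\phi(\cdot,x)$ is integrable on $[-1,1]$ with $\int_{-1}^1\phi(t,x)\,dt=\log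 x+c$. Let $\rho>1$ and let $E_\rho=\{\tfrac{\rho}{2}e^{i\theta}+\tfrac{\rho^{-1}}{2}e^{-i\theta}:\theta\in[0,2\pi]\}$ be the Bernstein ellipse. Assume that for every $x\in D$ the function $\phi(\cdot,x)$ extends to a function, again written $\phi(\cdot,x)$, that is continuous on the closed region bounded by $E_\rho$ and analytic in its interior, and that $$\sup\{|\phi(z,x)|: x\in D,\ z\in E_\rho\}\le L<\infty .$$ For $N\ge 1$ let $t_1,\dots,t_N$ and $w_1,\dots,w_N$ be the nodes and weights of $N$-point Gauss quadrature on $[-1,1]$ (the nodes are the $N$ distinct roots of the Legendre polynomial of degree $N$, and $w_k$ is the integral over $[-1,1]$ of the $k$-th Lagrange basis polynomial of these nodes), and let $$\widehat K^{sc}_{\phi,N}=\Big\{x\in\mathcal R^2\times\mathbb R:\ \exists v\in\mathbb R^N,\ \sum_{k=1}^N w_kv_k\ge x_3+c\,x_2,\ (x_1/x_2,\,v_k/x_2)\in\operatorname{hyp}\phi(t_k)\ \text{for } k=1,\dots,N\Big\}.$$ Then there is an absolute constant $C>0$ (independent of $M,\phi,c,\rho,L,\varepsilon$) such that for every $\varepsilon>0$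 and every integer $N\ge C\,\bigl(1+\log_\rho(1+L/\varepsilon)\bigr)$, which is a threshold of order $O(\log_\rho(L/\varepsilon))$ as soon as $L/\varepsilon\ge\max(2,\rho)$, the set $\widehat K^{sc}_{\phi,N}$ is SOC representable and $$K_{\exp}(-\varepsilon)\subseteq \widehat K^{sc}_{\phi,N}\subseteq K_{\exp}(\varepsilon).$$ -/

import Mathlib

noncomputable section

namespace ExpCone

/-- The Lorentz cone `{y ∈ ℝ^{q+1} : y_{q+1} ≥ √(y_1² + ⋯ + y_q²)}`. -/
def lorentzCone (q : ℕ) : Set (Fin (q + 1) → ℝ) :=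
  {y | Real.sqrt (∑ i : Fin q, y i.castSucc ^ 2) ≤ y (Fin.last q)}

/-- A set is second-order-cone representable if it is the projection of a set cut out, in the
original variables `x` and finitely many auxiliary variables `u`, by finitely many conditions
"a triple of affine functions of `(x, u)` lies in the three-dimensional Lorentz cone". -/
def IsSOCRepresentable {E : Type*} [AddCommGroup E] [Module ℝ E] (S : Set E) : Prop :=
  ∃ (n m : ℕ) (a : Fin m → Fin 3 → (E × (Fin n → ℝ)) →ᵃ[ℝ] ℝ),
    S = {x | ∃ u : Fin n → ℝ, ∀ i : Fin m, (fun j : Fin 3 => a i j (x, u)) ∈ lorentzCone 2}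

/-- The hypograph of `φ(t, ·)` over the domain `D`. -/
def hypPhi (D : Set ℝ) (φ : ℝ → ℝ → ℝ) (t : ℝ) : Set (ℝ × ℝ) :=
  {p | p.1 ∈ D ∧ p.2 ≤ φ t p.1}

/-- `φ : [-1,1] × D → ℝ` is a generating function for the logarithm on `D`, with additive
constant `c` in the integral identity. Only values at `t ∈ [-1,1]`, `x ∈ D` matter. -/
structure IsGeneratingFunction (D : Set ℝ) (φ : ℝ → ℝ → ℝ) (c : ℝ) : Prop where
  concave : ∀ t ∈ Set.Icc (-1 : ℝ) 1, ConcaveOn ℝ D (φ t)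
  continuous : ∀ t ∈ Set.Icc (-1 : ℝ) 1, ContinuousOn (φ t) D
  soc : ∀ t ∈ Set.Icc (-1 : ℝ) 1, IsSOCRepresentable (hypPhi D φ t)
  integrable : ∀ x ∈ D, IntervalIntegrable (fun t => φ t x) MeasureTheory.volume (-1) 1
  integral_eq : ∀ x ∈ D, ∫ t in (-1 : ℝ)..1, φ t x = Real.log x + c

/-- The open region bounded by the Bernstein ellipse: foci `±1`, sum of semi-axes `ρ`. -/
def bernsteinRegion (ρ : ℝ) : Set ℂ :=
  {z | ‖z - 1‖ + ‖z + 1‖ < ρ + ρ⁻¹}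

/-- The point of the Bernstein ellipse with parameter `θ`. -/
def bernsteinPoint (ρ θ : ℝ) : ℂ :=
  (ρ : ℂ) / 2 * Complex.exp (Complex.I * θ) + (ρ : ℂ)⁻¹ / 2 * Complex.exp (-(Complex.I * θ))

/-- For every `x ∈ D`, the function `φ(·, x)` on `[-1,1]` has an analytic continuation to the
region bounded by the Bernstein ellipse, continuous up to the ellipse, and the absolute value of
the continuation is at most `L` on the ellipse, that is,
`sup {|φ(z, x)| : x ∈ D, z on the ellipse} ≤ L`. -/
def HasBernsteinBound (D : Set ℝ) (φ : ℝ → ℝ → ℝ) (ρ L : ℝ) : Prop :=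
  ∀ x ∈ D, ∃ F : ℂ → ℂ,
    DiffContOnCl ℂ F (bernsteinRegion ρ) ∧
    (∀ t ∈ Set.Icc (-1 : ℝ) 1, F (t : ℂ) = (φ t x : ℂ)) ∧
    ∀ θ ∈ Set.Icc (0 : ℝ) (2 * Real.pi), ‖F (bernsteinPoint ρ θ)‖ ≤ L

/-- The Legendre polynomial of degree `N` on `[-1,1]` (Rodrigues' formula). -/
def legendre (N : ℕ) : Polynomial ℝ :=
  Polynomial.C ((2 : ℝ) ^ N * (N.factorial : ℝ))⁻¹ *
    Polynomial.derivative^[N] ((Polynomial.X ^ 2 - 1) ^ N)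

/-- `N`-point Gauss quadrature on `[-1,1]`: the nodes are `N` distinct roots of the Legendre
polynomial of degree `N`, and the weights integrate the interpolating polynomial. -/
structure IsGaussQuadrature (N : ℕ) (t w : Fin N → ℝ) : Prop where
  injective : Function.Injective t
  isRoot : ∀ k, (legendre N).IsRoot (t k)
  weight_eq : ∀ k, w k = ∫ s in (-1 : ℝ)..1, (Lagrange.basis Finset.univ t k).eval s

/-- `hyp log (α) = {(x, v) : log x ≥ v - α}`. -/
def hypLog (α : ℝ) : Set (ℝ × ℝ) :=
  {p | 0 < p.1 ∧ p.2 - α ≤ Real.log p.1}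

/-- The parametric exponential cone, with `x₁, x₂ ∈ [1/M, M]`. -/
def Kexp (M α : ℝ) : Set (Fin 3 → ℝ) :=
  {x | x 0 ∈ Set.Icc (1 / M) M ∧ x 1 ∈ Set.Icc (1 / M) M ∧ (x 0 / x 1, x 2 / x 1) ∈ hypLog α}

/-- The range `[1/M², M²]` of the ratio `x₁ / x₂`. -/
def ratioRange (M : ℝ) : Set ℝ := Set.Icc (1 / M ^ 2) (M ^ 2)

/-- The approximating set built from the hypographs of `φ(t_k, ·)`. -/
def Ksc (M : ℝ) (φ : ℝ → ℝ → ℝ) (c : ℝ) {N : ℕ} (t w : Fin N → ℝ) : Set (Fin 3 → ℝ) :=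
  {x | x 0 ∈ Set.Icc (1 / M) M ∧ x 1 ∈ Set.Icc (1 / M) M ∧
    ∃ v : Fin N → ℝ, x 2 + c * x 1 ≤ ∑ k, w k * v k ∧
      ∀ k, (x 0 / x 1, v k / x 1) ∈ hypPhi (ratioRange M) φ (t k)}

end ExpCone

end

/-! After division by `x 1`, both inclusions compare `x 2 / x 1 + c` with the Gauss sum of `φ (t k)
(x 0 / x 1)`, the weights being nonnegative. So they follow from one uniform estimate on `ratioRange
M`: that sum is within `ε` of `log x + c` (`abs_log_add_sub_sum_le`).

Gauss quadrature is exact below degree `2 N`, and its weights are nonnegative with sum 2. Its error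
is therefore at most four times the uniform distance to such polynomials
(`abs_integral_sub_sum_le`), and `exists_polynomial_approx` bounds that distance by `6 L ρ⁻ᴺ`.

Bounding the tail of the Chebyshev series term by term would cost a factor of order `1 / (ρ - 1)`,
incompatible with an absolute `C`. Instead the high frequencies are removed by Fourier multipliers
(`exists_trigPoly_approx`). The Joukowski map pulls the function back to the annulus `r⁻¹ ≤ ‖w‖ ≤ r`
with `r = √ρ`. If `c k` are its coefficients on the unit circle, the sum of its values on the two
boundary circles has coefficients `(r ^ k + r ^ (-k)) c k`. Combined shifts of the Poisson kernel
give multipliers that equal `q ^ |k|` for `|k| ≥ n` and have norm at most `2 qⁿ`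
(`exists_hasSum_tailWeight`). Applied with `q = r⁻¹` to the boundary sum and with `q = r⁻²` to the
unit circle, they give two functions whose difference has coefficient `c k` for every `|k| ≥ n` and
norm at most `6 L r⁻ⁿ`. Then `n = 2 N` is used.

Representability is a separate matter of homogenisation (`isSOCRepresentable_Ksc`). -/

namespace ExpCone

/-! ### Legendre polynomials: orthogonality and roots. -/

open Polynomial

/-- Integration by parts for polynomials. -/
theorem integral_eval_derivative_mul (p q : ℝ[X]) (a b : ℝ) :
    ∫ x in a..b, (derivative p * q).eval x =
      p.eval b * q.eval b - p.eval a * q.eval a - ∫ x in a..b, (p * derivative q).eval x := by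
  have h := intervalIntegral.integral_mul_deriv_eq_deriv_mul (a := a) (b := b)
    (u := fun x => q.eval x) (v := fun x => p.eval x)
    (fun x _ => q.hasDerivAt x) (fun x _ => p.hasDerivAt x)
    ((derivative q).continuous.intervalIntegrable _ _)
    ((derivative p).continuous.intervalIntegrable _ _)
  simp only [eval_mul]
  rw [← intervalIntegral.integral_congr (f := fun x => eval x q * eval x (derivative p))
    (fun x _ => mul_comm _ _), h]
  rw [← intervalIntegral.integral_congr (f := fun x => eval x (derivative q) * eval x p)
    (fun x _ => mul_comm _ _)]
  ring

/-- Each integration by parts moves one derivative onto `q`, with vanishing boundary terms, until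
`q` has been differentiated away. -/
theorem integral_iterate_derivative_mul_eq_zero {p : ℝ[X]} {a b : ℝ} {N : ℕ}
    (ha : ∀ i < N, (derivative^[i] p).eval a = 0) (hb : ∀ i < N, (derivative^[i] p).eval b = 0)
    {j : ℕ} (hj : j ≤ N) {q : ℝ[X]} (hq : q.degree < j) :
    ∫ x in a..b, (derivative^[j] p * q).eval x = 0 := by
  induction j generalizing q with
  | zero =>
    have : q = 0 := by
      rw [← degree_eq_bot]
      exact Nat.WithBot.lt_zero_iff.mp hq
    simp [this]
  | succ j ih =>
    rw [Function.iterate_succ_apply', integral_eval_derivative_mul, ha j hj, hb j hj,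
      ih (by omega)]
    · simp
    · by_cases h0 : q = 0
      · simp [h0]
      · have h1 := degree_derivative_lt h0
        rw [degree_eq_natDegree h0] at hq h1
        have h2 : q.natDegree ≤ j := by
          have : q.natDegree < j + 1 := by exact_mod_cast hq
          omega
        exact h1.trans_le (by exact_mod_cast h2)

theorem eval_iterate_derivative_sq_sub_one_pow {N i : ℕ} (hi : i < N) {a : ℝ} (ha : a ^ 2 = 1) :
    (derivative^[i] ((X ^ 2 - 1 : ℝ[X]) ^ N)).eval a = 0 := by
  have hd : (X - C a) ^ N ∣ (X ^ 2 - 1 : ℝ[X]) ^ N := by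
    refine pow_dvd_pow_of_dvd ?_ N
    rw [dvd_iff_isRoot]
    simp [ha]
  have h := (dvd_pow_self (X - C a) (by omega : N - i ≠ 0)).trans
    (pow_sub_dvd_iterate_derivative_of_pow_dvd i hd)
  exact dvd_iff_isRoot.mp h

theorem integral_legendre_mul_eq_zero {N : ℕ} {q : ℝ[X]} (hq : q.degree < N) :
    ∫ x in (-1 : ℝ)..1, (legendre N * q).eval x = 0 := by
  have h := integral_iterate_derivative_mul_eq_zero (p := (X ^ 2 - 1 : ℝ[X]) ^ N) (a := -1) (b := 1)
    (fun i hi => eval_iterate_derivative_sq_sub_one_pow hi (by norm_num))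
    (fun i hi => eval_iterate_derivative_sq_sub_one_pow hi (by norm_num)) le_rfl hq
  simp only [legendre, mul_assoc, eval_C_mul]
  rw [intervalIntegral.integral_const_mul, h, mul_zero]

theorem natDegree_legendre_le (N : ℕ) : (legendre N).natDegree ≤ N := by
  refine (natDegree_C_mul_le _ _).trans ((natDegree_iterate_derivative _ _).trans ?_)
  have : ((X ^ 2 - 1 : ℝ[X]) ^ N).natDegree ≤ N * 2 :=
    natDegree_pow_le.trans (Nat.mul_le_mul le_rfl (by compute_degree))
  omega

theorem card_roots_le_iterate_derivative (p : ℝ[X]) (j : ℕ) :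
    p.roots.card ≤ (derivative^[j] p).roots.card + j := by
  induction j with
  | zero => simp
  | succ j ih =>
    rw [Function.iterate_succ_apply']
    have := card_roots_le_derivative (derivative^[j] p)
    omega

/-- `(X ^ 2 - 1) ^ N` has `2 N` roots with multiplicity, and by Rolle each derivative loses at most
one. -/
theorem le_card_roots_legendre (N : ℕ) : N ≤ (legendre N).roots.card := by
  have h0 : ((2 : ℝ) ^ N * (N.factorial : ℝ))⁻¹ ≠ 0 := by positivity
  rw [legendre, roots_C_mul _ h0]
  have h1 := card_roots_le_iterate_derivative ((X ^ 2 - 1 : ℝ[X]) ^ N) N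
  have h2 : (X ^ 2 - 1 : ℝ[X]) = (X - C 1) * (X - C (-1)) := by
    simp; ring
  have h3 : ((X ^ 2 - 1 : ℝ[X]) ^ N).roots.card = 2 * N := by
    rw [roots_pow, h2, roots_mul (mul_ne_zero (X_sub_C_ne_zero _) (X_sub_C_ne_zero _)),
      roots_X_sub_C, roots_X_sub_C]
    simp [mul_comm]
  omega

theorem card_roots_legendre (N : ℕ) : (legendre N).roots.card = N :=
  le_antisymm ((card_roots' _).trans (natDegree_legendre_le N)) (le_card_roots_legendre N)

theorem natDegree_legendre (N : ℕ) : (legendre N).natDegree = N :=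
  le_antisymm (natDegree_legendre_le N) ((le_card_roots_legendre N).trans (card_roots' _))

theorem legendre_ne_zero {N : ℕ} (hN : N ≠ 0) : legendre N ≠ 0 := by
  intro h
  have := natDegree_legendre N
  rw [h, natDegree_zero] at this
  exact hN this.symm

/-- A polynomial that is nonnegative on `[-1, 1]` and has zero integral there vanishes. -/
theorem eq_zero_of_integral_eq_zero {p : ℝ[X]} (hp : ∀ x ∈ Set.Icc (-1 : ℝ) 1, 0 ≤ p.eval x)
    (h : ∫ x in (-1 : ℝ)..1, p.eval x = 0) : p = 0 := by
  have h0 : ∀ x ∈ Set.Icc (-1 : ℝ) 1, p.eval x = 0 := by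
    intro x hx
    by_contra hne
    have hpos : 0 < p.eval x := lt_of_le_of_ne (hp x hx) (Ne.symm hne)
    have := intervalIntegral.integral_pos (a := -1) (b := 1) (by norm_num)
      (p.continuous.continuousOn) (fun y hy => hp y (Set.Ioc_subset_Icc_self hy)) ⟨x, hx, hpos⟩
    exact this.ne' h
  exact eq_zero_of_infinite_isRoot p
    ((Set.Icc_infinite (by norm_num : (-1 : ℝ) < 1)).mono fun x hx => h0 x hx)

/-- Makes `legendre N` orthogonal to the cofactor `q`. As `legendre N * q = p * q ^ 2`, a
contradiction arises whenever `p` has constant sign on `[-1, 1]`. -/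
theorem legendre_factor_degree_lt {N : ℕ} (hN : N ≠ 0) {p q : ℝ[X]} (h : legendre N = p * q)
    (hp : 0 < p.natDegree) : q ≠ 0 ∧ q.degree < N := by
  have h0 := legendre_ne_zero hN
  have hp0 : p ≠ 0 := by rintro rfl; simp at hp
  have hq0 : q ≠ 0 := by rintro rfl; exact h0 (by simp [h])
  refine ⟨hq0, ?_⟩
  have := natDegree_mul hp0 hq0
  rw [← h, natDegree_legendre] at this
  rw [degree_eq_natDegree hq0]
  exact_mod_cast (by omega : q.natDegree < N)

theorem isRoot_legendre_ne_zero {N : ℕ} {t : ℝ} (ht : (legendre N).IsRoot t) : N ≠ 0 := by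
  rintro rfl
  simp [legendre, IsRoot] at ht

/-- The roots of the Legendre polynomial lie in `(-1, 1)`. -/
theorem mem_Ioo_of_isRoot_legendre {N : ℕ} {t : ℝ} (ht : (legendre N).IsRoot t) :
    t ∈ Set.Ioo (-1 : ℝ) 1 := by
  obtain ⟨q, hq⟩ := dvd_iff_isRoot.mpr ht
  obtain ⟨hq0, hdeg⟩ := legendre_factor_degree_lt (isRoot_legendre_ne_zero ht) hq (by simp)
  have hint := integral_legendre_mul_eq_zero hdeg
  have hne : legendre N * q ≠ 0 := mul_ne_zero (legendre_ne_zero (isRoot_legendre_ne_zero ht)) hq0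
  by_contra hmem
  rw [Set.mem_Ioo, not_and_or, not_lt, not_lt] at hmem
  rcases hmem with h | h
  · refine hne (eq_zero_of_integral_eq_zero (fun x hx => ?_) hint)
    rw [hq]
    simp only [eval_mul, eval_sub, eval_X, eval_C]
    have : 0 ≤ x - t := by linarith [hx.1]
    nlinarith [mul_nonneg this (mul_self_nonneg (q.eval x))]
  · refine neg_ne_zero.mpr hne (eq_zero_of_integral_eq_zero (p := -(legendre N * q))
      (fun x hx => ?_) (by simpa using hint))
    rw [hq]
    simp only [eval_mul, eval_sub, eval_X, eval_C, eval_neg]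
    have : 0 ≤ t - x := by linarith [hx.2]
    nlinarith [mul_nonneg this (mul_self_nonneg (q.eval x))]

/-- A double root would give a factor `p = (X - t) ^ 2`, which is nonnegative. -/
theorem nodup_roots_legendre (N : ℕ) : (legendre N).roots.Nodup := by
  rw [Multiset.nodup_iff_count_le_one]
  intro t
  rw [count_roots]
  by_contra! h
  have hroot : (legendre N).IsRoot t := by
    by_contra hn
    rw [rootMultiplicity_eq_zero hn] at h
    omega
  have hN := isRoot_legendre_ne_zero hroot
  obtain ⟨q, hq⟩ := (le_rootMultiplicity_iff (legendre_ne_zero hN)).mp h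
  obtain ⟨hq0, hdeg⟩ := legendre_factor_degree_lt hN hq (by simp)
  refine mul_ne_zero (legendre_ne_zero hN) hq0
    (eq_zero_of_integral_eq_zero (fun x _ => ?_) (integral_legendre_mul_eq_zero hdeg))
  rw [hq]
  simp only [eval_mul, eval_sub, eval_X, eval_C, eval_pow]
  nlinarith [sq_nonneg ((x - t) * q.eval x)]

theorem exists_isGaussQuadrature (N : ℕ) : ∃ t w : Fin N → ℝ, IsGaussQuadrature N t w := by
  have hcard : (legendre N).roots.toFinset.card = N := by
    rw [Multiset.toFinset_card_of_nodup (nodup_roots_legendre N), card_roots_legendre]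
  let e := (legendre N).roots.toFinset.equivFinOfCardEq hcard
  refine ⟨fun k => (e.symm k : ℝ), _, ⟨?_, ?_, fun k => rfl⟩⟩
  · exact Subtype.val_injective.comp e.symm.injective
  · intro k
    exact isRoot_of_mem_roots (Multiset.mem_toFinset.mp (e.symm k).2)

/-! ### Gauss quadrature: exactness, positivity, error. -/

namespace IsGaussQuadrature

variable {N : ℕ} {t w : Fin N → ℝ}

theorem integral_eq_sum_of_degree_lt (h : IsGaussQuadrature N t w) {p : ℝ[X]} (hp : p.degree < N) :
    ∫ x in (-1 : ℝ)..1, p.eval x = ∑ k, w k * p.eval (t k) := by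
  have h1 := Lagrange.eq_interpolate (s := Finset.univ) (v := t) (f := p) h.injective.injOn
    (by simpa using hp)
  have h2 : ∀ x, p.eval x = ∑ k, p.eval (t k) * (Lagrange.basis Finset.univ t k).eval x := by
    intro x
    conv_lhs => rw [h1]
    simp [Lagrange.interpolate_apply, eval_finsetSum]
  rw [intervalIntegral.integral_congr (fun x _ => h2 x), intervalIntegral.integral_finsetSum]
  · refine Finset.sum_congr rfl fun k _ => ?_
    rw [intervalIntegral.integral_const_mul, h.weight_eq k, mul_comm]
  · intro k _
    exact (((Lagrange.basis Finset.univ t k).continuous).const_mul _).intervalIntegrable _ _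

/-- `N`-point Gauss quadrature is exact on polynomials of degree less than `2 N`. -/
theorem integral_eq_sum (h : IsGaussQuadrature N t w) {p : ℝ[X]} (hp : p.degree < (2 * N : ℕ)) :
    ∫ x in (-1 : ℝ)..1, p.eval x = ∑ k, w k * p.eval (t k) := by
  rcases eq_or_ne N 0 with rfl | hN
  · exact h.integral_eq_sum_of_degree_lt (by simpa using hp)
  have h0 := legendre_ne_zero hN
  have hdl : (legendre N).degree = N := by rw [degree_eq_natDegree h0, natDegree_legendre]
  have hr : (p % legendre N).degree < N := hdl ▸ degree_mod_lt p h0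
  -- The multiple of `legendre N` integrates to zero by orthogonality and vanishes at the nodes, so
  -- only the remainder counts.
  have hdiv := EuclideanDomain.div_add_mod p (legendre N)
  have hq : (p / legendre N).degree < N := by
    rcases lt_or_ge p.degree (legendre N).degree with hlt | hge
    · rw [(Polynomial.div_eq_zero_iff h0).mpr hlt, degree_zero]
      exact WithBot.bot_lt_coe _
    · have h1 := degree_add_div h0 hge
      by_contra hn
      rw [not_lt] at hn
      have h2 := add_le_add_right hn (legendre N).degree
      rw [h1, hdl] at h2
      refine absurd (h2.trans_lt hp) (not_lt.mpr ?_)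
      exact_mod_cast (by omega : 2 * N ≤ N + N)
  have hev : ∀ x, p.eval x = (legendre N * (p / legendre N)).eval x + (p % legendre N).eval x := by
    intro x
    rw [← eval_add, hdiv]
  rw [intervalIntegral.integral_congr (fun x _ => hev x), intervalIntegral.integral_add
    ((legendre N * (p / legendre N)).continuous.intervalIntegrable _ _)
    ((p % legendre N).continuous.intervalIntegrable _ _), integral_legendre_mul_eq_zero hq, zero_add,
    h.integral_eq_sum_of_degree_lt hr]
  refine Finset.sum_congr rfl fun k _ => ?_
  have hk : (legendre N).eval (t k) = 0 := h.isRoot k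
  rw [hev (t k), eval_mul, hk, zero_mul, zero_add]

/-- The square of the `k`-th Lagrange polynomial has degree `2 N - 2`, so exactness identifies its
integral with `w k`. -/
theorem weight_nonneg (h : IsGaussQuadrature N t w) (k : Fin N) : 0 ≤ w k := by
  have hN : 0 < N := k.pos
  have hdeg : ((Lagrange.basis Finset.univ t k) ^ 2).degree < (2 * N : ℕ) := by
    refine lt_of_le_of_lt degree_le_natDegree ?_
    rw [natDegree_pow, Lagrange.natDegree_basis h.injective.injOn (Finset.mem_univ k)]
    simp only [Finset.card_univ, Fintype.card_fin]
    exact_mod_cast (by omega : 2 * (N - 1) < 2 * N)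
  have h1 := h.integral_eq_sum hdeg
  rw [Finset.sum_eq_single k] at h1
  · rw [eval_pow, Lagrange.eval_basis_self h.injective.injOn (Finset.mem_univ k)] at h1
    have h2 : 0 ≤ ∫ x in (-1 : ℝ)..1, ((Lagrange.basis Finset.univ t k) ^ 2).eval x := by
      refine intervalIntegral.integral_nonneg (by norm_num) fun x _ => ?_
      rw [eval_pow]
      positivity
    linarith
  · intro j _ hj
    rw [eval_pow, Lagrange.eval_basis_of_ne hj.symm (Finset.mem_univ j)]
    simp
  · simp

theorem sum_weight (h : IsGaussQuadrature N t w) (hN : N ≠ 0) : ∑ k, w k = 2 := by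
  have h1 := h.integral_eq_sum (p := 1) (by
    rw [degree_one]
    exact_mod_cast (by omega : 0 < 2 * N))
  norm_num at h1
  exact h1.symm

theorem node_mem (h : IsGaussQuadrature N t w) (k : Fin N) : t k ∈ Set.Icc (-1 : ℝ) 1 :=
  Set.Ioo_subset_Icc_self (mem_Ioo_of_isRoot_legendre (h.isRoot k))

/-- The quadrature error is at most four times the distance to polynomials of degree less than
`2 N`. -/
theorem abs_integral_sub_sum_le (h : IsGaussQuadrature N t w) (hN : N ≠ 0) {f : ℝ → ℝ}
    (hf : IntervalIntegrable f MeasureTheory.volume (-1) 1) {p : ℝ[X]}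
    (hp : p.degree < (2 * N : ℕ)) {δ : ℝ}
    (hδ : ∀ x ∈ Set.Icc (-1 : ℝ) 1, |f x - p.eval x| ≤ δ) :
    |(∫ x in (-1 : ℝ)..1, f x) - ∑ k, w k * f (t k)| ≤ 4 * δ := by
  -- The 4 is the interval length 2 plus the total weight 2.
  have h1 : |∫ x in (-1 : ℝ)..1, (f x - p.eval x)| ≤ 2 * δ := by
    have := intervalIntegral.norm_integral_le_of_norm_le_const (a := -1) (b := 1)
      (f := fun x => f x - p.eval x) (C := δ) (fun x hx => by
        rw [Set.uIoc_of_le (by norm_num)] at hx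
        exact hδ x (Set.Ioc_subset_Icc_self hx))
    rw [Real.norm_eq_abs] at this
    norm_num at this
    linarith
  have h2 : |∑ k, w k * (f (t k) - p.eval (t k))| ≤ 2 * δ := by
    refine (Finset.abs_sum_le_sum_abs _ _).trans ?_
    rw [← h.sum_weight hN, Finset.sum_mul]
    refine Finset.sum_le_sum fun k _ => ?_
    rw [abs_mul, abs_of_nonneg (h.weight_nonneg k)]
    exact mul_le_mul_of_nonneg_left (hδ _ (h.node_mem k)) (h.weight_nonneg k)
  rw [intervalIntegral.integral_sub hf (p.continuous.intervalIntegrable _ _),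
    h.integral_eq_sum hp] at h1
  simp only [mul_sub, Finset.sum_sub_distrib] at h2
  rw [abs_le] at *
  constructor <;> linarith [h1.1, h1.2, h2.1, h2.2]

end IsGaussQuadrature

end ExpCone

/-! ### Second-order-cone representability. -/

namespace ExpCone

theorem mem_lorentzCone_two {y : Fin 3 → ℝ} :
    y ∈ lorentzCone 2 ↔ Real.sqrt (y 0 ^ 2 + y 1 ^ 2) ≤ y 2 := by
  simp [lorentzCone, Fin.sum_univ_two, Fin.last]

theorem mul_mem_lorentzCone_two {y : Fin 3 → ℝ} {s : ℝ} (hs : 0 < s) :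
    (fun j => s * y j) ∈ lorentzCone 2 ↔ y ∈ lorentzCone 2 := by
  rw [mem_lorentzCone_two, mem_lorentzCone_two]
  have : (s * y 0) ^ 2 + (s * y 1) ^ 2 = s ^ 2 * (y 0 ^ 2 + y 1 ^ 2) := by ring
  rw [this, Real.sqrt_mul (sq_nonneg s), Real.sqrt_sq hs.le, mul_le_mul_iff_right₀ hs]

theorem nonneg_iff_mem_lorentzCone_two {r : ℝ} :
    ![0, 0, r] ∈ lorentzCone 2 ↔ 0 ≤ r := by
  simp [mem_lorentzCone_two]

variable {E : Type*} [AddCommGroup E] [Module ℝ E]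

/-- Arbitrary finite types may index the auxiliary variables and the constraints. -/
theorem isSOCRepresentable_of_fintype {ι κ : Type*} [Fintype ι] [Fintype κ] {S : Set E}
    (a : ι → Fin 3 → (E × (κ → ℝ)) →ᵃ[ℝ] ℝ)
    (hS : S = {x | ∃ u : κ → ℝ, ∀ i, (fun j => a i j (x, u)) ∈ lorentzCone 2}) :
    IsSOCRepresentable S := by
  classical
  let eι := Fintype.equivFin ι
  let eκ := Fintype.equivFin κ
  let T : (E × (Fin (Fintype.card κ) → ℝ)) →ₗ[ℝ] (E × (κ → ℝ)) :=
    LinearMap.prodMap LinearMap.id (LinearMap.funLeft ℝ ℝ eκ)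
  have hT : ∀ x u, T (x, u) = (x, u ∘ eκ) := fun x u => rfl
  refine ⟨Fintype.card κ, Fintype.card ι,
    fun i j => (a (eι.symm i) j).comp T.toAffineMap, ?_⟩
  rw [hS]
  ext x
  simp only [Set.mem_ofPred_eq, AffineMap.comp_apply, LinearMap.coe_toAffineMap, hT]
  constructor
  · rintro ⟨u, hu⟩
    refine ⟨u ∘ eκ.symm, fun i => ?_⟩
    have : (u ∘ eκ.symm) ∘ eκ = u := by ext; simp
    rw [this]
    exact hu _
  · rintro ⟨u, hu⟩
    refine ⟨u ∘ eκ, fun i => ?_⟩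
    simpa using hu (eι i)

/-- The perspective `s * f (y / s)` of an affine function `f`, as a linear function of `(y, s)`. -/
def perspective {F : Type*} [AddCommGroup F] [Module ℝ F] (f : F →ᵃ[ℝ] ℝ) : F × ℝ →ₗ[ℝ] ℝ :=
  f.linear.comp (LinearMap.fst ℝ F ℝ) + f 0 • LinearMap.snd ℝ F ℝ

theorem perspective_smul {F : Type*} [AddCommGroup F] [Module ℝ F] (f : F →ᵃ[ℝ] ℝ) (y : F)
    (s : ℝ) : perspective f (s • y, s) = s * f y := by
  have h := congrFun f.decomp y
  simp only [Pi.add_apply] at h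
  rw [h]
  simp [perspective]
  ring

/-- The Lorentz cone is invariant under scaling by `x 1 > 0`. Multiplying each constraint on `(x 0 /
x 1, v k / x 1, u)` by `x 1` makes it linear in `x`, `v` and the new auxiliary variables `x 1 * u`.
-/
theorem isSOCRepresentable_Ksc {M : ℝ} (hM : 0 < M) {φ : ℝ → ℝ → ℝ} {c : ℝ} {N : ℕ}
    {t w : Fin N → ℝ} (h : ∀ k, IsSOCRepresentable (hypPhi (ratioRange M) φ (t k))) :
    IsSOCRepresentable (Ksc M φ c t w) := by
  choose n m a ha using h
  let G := (Fin 3 → ℝ) × ((Fin N ⊕ (Σ k, Fin (n k))) → ℝ)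
  let X : Fin 3 → G →ₗ[ℝ] ℝ := fun i => (LinearMap.proj i).comp (LinearMap.fst ℝ _ _)
  let V : Fin N → G →ₗ[ℝ] ℝ := fun k => (LinearMap.proj (Sum.inl k)).comp (LinearMap.snd ℝ _ _)
  let U : (Σ k, Fin (n k)) → G →ₗ[ℝ] ℝ := fun q =>
    (LinearMap.proj (Sum.inr q)).comp (LinearMap.snd ℝ _ _)
  let A : (k : Fin N) → G →ₗ[ℝ] (((ℝ × ℝ) × (Fin (n k) → ℝ)) × ℝ) := fun k =>
    (((X 0).prod (V k)).prod (LinearMap.pi fun l => U ⟨k, l⟩)).prod (X 1)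
  let cst : ℝ → G →ᵃ[ℝ] ℝ := fun r => AffineMap.const ℝ G r
  -- The scalar constraints, each imposed by putting `(0, 0, lin i)` in the cone.
  let lin : Fin 5 → G →ᵃ[ℝ] ℝ := ![(X 0).toAffineMap - cst (1 / M), cst M - (X 0).toAffineMap,
    (X 1).toAffineMap - cst (1 / M), cst M - (X 1).toAffineMap,
    (∑ k, w k • V k - X 2 - c • X 1).toAffineMap]
  refine isSOCRepresentable_of_fintype (ι := Fin 5 ⊕ (Σ k, Fin (m k)))
    (κ := Fin N ⊕ (Σ k, Fin (n k)))
    (Sum.elim (fun i => ![0, 0, lin i])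
      (fun q j => ((perspective (a q.1 q.2 j)).comp (A q.1)).toAffineMap)) ?_
  ext x
  have hlin : ∀ (i : Fin 5) (g : G), ((fun j => (![0, 0, lin i] : Fin 3 → G →ᵃ[ℝ] ℝ) j g) ∈
      lorentzCone 2) ↔ 0 ≤ lin i g := by
    intro i g
    rw [← nonneg_iff_mem_lorentzCone_two]
    apply iff_of_eq
    congr 1
    ext j
    fin_cases j <;> rfl
  have hper : ∀ (k : Fin N) (v : Fin N → ℝ) (u : (Σ k, Fin (n k)) → ℝ) (i : Fin (m k)), 0 < x 1 →
      (((fun j => ((perspective (a k i j)).comp (A k)).toAffineMap (x, Sum.elim v u)) ∈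
      lorentzCone 2) ↔ (fun j => a k i j ((x 0 / x 1, v k / x 1), fun l => (x 1)⁻¹ * u ⟨k, l⟩)) ∈
      lorentzCone 2) := by
    intro k v u i hx
    refine Iff.trans ?_ (mul_mem_lorentzCone_two hx)
    apply iff_of_eq
    congr 1
    ext j
    refine Eq.trans ?_ (perspective_smul _ _ _)
    have : A k (x, Sum.elim v u) = (((x 0, v k), fun l => u ⟨k, l⟩), x 1) := rfl
    change perspective (a k i j) (A k (x, Sum.elim v u)) = _
    rw [this]
    congr 2
    ext l
    · simp [mul_div_cancel₀ _ hx.ne']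
    · simp [mul_div_cancel₀ _ hx.ne']
    · simp [hx.ne']
  have hbox : ∀ (v : Fin N → ℝ) (u : (Σ k, Fin (n k)) → ℝ),
      (∀ i, 0 ≤ lin i (x, Sum.elim v u)) ↔ x 0 ∈ Set.Icc (1 / M) M ∧ x 1 ∈ Set.Icc (1 / M) M ∧
        x 2 + c * x 1 ≤ ∑ k, w k * v k := by
    intro v u
    have hX : ∀ i, X i (x, Sum.elim v u) = x i := fun i => rfl
    have hV : ∀ k, V k (x, Sum.elim v u) = v k := fun k => rfl
    have hc : ∀ r, cst r (x, Sum.elim v u) = r := fun r => rfl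
    simp only [Fin.forall_fin_succ, lin, Matrix.cons_val_zero, Matrix.cons_val_succ,
      AffineMap.coe_sub, Pi.sub_apply, LinearMap.coe_toAffineMap, hX, hc, LinearMap.sub_apply,
      LinearMap.sum_apply, LinearMap.smul_apply, hV, smul_eq_mul, sub_nonneg, Set.mem_Icc,
      IsEmpty.forall_iff, and_true, and_assoc]
    rw [le_sub_iff_add_le']
  have hpos : 0 < 1 / M := by positivity
  simp only [Set.mem_ofPred_eq, Sum.forall, Sum.elim_inl, Sum.elim_inr, hlin, Sigma.forall]
  constructor
  · rintro ⟨h0, h1, v, hv, hk⟩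
    have hx : 0 < x 1 := hpos.trans_le h1.1
    simp only [ha] at hk
    choose u hu using hk
    refine ⟨Sum.elim v fun q => x 1 * u q.1 q.2, (hbox _ _).mpr ⟨h0, h1, hv⟩, fun k i => ?_⟩
    rw [hper k _ _ i hx]
    simpa [← mul_assoc, hx.ne'] using hu k i
  · rintro ⟨y, hy, hk⟩
    obtain ⟨v, u, rfl⟩ : ∃ v u, y = Sum.elim v u :=
      ⟨_, _, (Sum.elim_comp_inl_inr y).symm⟩
    obtain ⟨h0, h1, hv⟩ := (hbox v u).mp hy
    have hx : 0 < x 1 := hpos.trans_le h1.1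
    refine ⟨h0, h1, v, hv, fun k => ?_⟩
    rw [ha]
    exact ⟨_, fun i => (hper k v u i hx).mp (hk k i)⟩

end ExpCone

/-! ### Poisson kernel and Fourier multipliers. -/

namespace ExpCone

open Complex MeasureTheory

/-- Fourier coefficients of a function on `[0, 2π]`. -/
noncomputable def circleCoeff (h : ℝ → ℂ) (k : ℤ) : ℂ :=
  (2 * Real.pi : ℂ)⁻¹ * ∫ s in (0 : ℝ)..2 * Real.pi, h s * exp (-(k * s * I))

theorem hasSum_of_forall_eq {ι : Type*} {f g : ι → ℂ} {a : ℂ} (hfg : ∀ i, f i = g i)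
    (hg : HasSum g a) : HasSum f a :=
  (funext hfg : f = g) ▸ hg

theorem summable_pow_natAbs {q : ℝ} (hq0 : 0 ≤ q) (hq1 : q < 1) :
    Summable fun k : ℤ => q ^ k.natAbs := by
  have h := summable_geometric_of_lt_one hq0 hq1
  refine Summable.of_nat_of_neg_add_one (by simpa using h) ?_
  have h2 : ∀ n : ℕ, (-((n : ℤ) + 1)).natAbs = n + 1 := by intro n; omega
  simp only [h2]
  exact (summable_nat_add_iff 1).mpr h

theorem one_sub_mul_exp_ne_zero {q : ℝ} (hq0 : 0 ≤ q) (hq1 : q < 1) (x : ℝ) :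
    1 - (q : ℂ) * exp (x * I) ≠ 0 := by
  intro h
  have : ‖(q : ℂ) * exp (x * I)‖ = 1 := by rw [← sub_eq_zero.mp h]; simp
  rw [norm_mul, norm_exp_ofReal_mul_I, mul_one, norm_real, Real.norm_of_nonneg hq0] at this
  exact hq1.ne this

/-- The Fourier series of the Poisson kernel. -/
theorem hasSum_poisson {q : ℝ} (hq0 : 0 ≤ q) (hq1 : q < 1) (x : ℝ) :
    HasSum (fun k : ℤ => (q : ℂ) ^ k.natAbs * exp (k * x * I))
      (((1 - q ^ 2) / ‖1 - (q : ℂ) * exp (x * I)‖ ^ 2 : ℝ) : ℂ) := by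
  obtain ⟨z, hz⟩ : ∃ z : ℂ, z = q * exp (x * I) := ⟨_, rfl⟩
  obtain ⟨y, hy⟩ : ∃ y : ℂ, y = (starRingEnd ℂ) z := ⟨_, rfl⟩
  have hyq : y = q * exp (-(x * I)) := by
    rw [hy, hz, map_mul, conj_ofReal, ← exp_conj, map_mul, conj_ofReal, conj_I, mul_neg]
  have hzn : ‖z‖ < 1 := by
    rw [hz, norm_mul, norm_exp_ofReal_mul_I, mul_one, norm_real, Real.norm_of_nonneg hq0]
    exact hq1
  have hyn : ‖y‖ < 1 := by rwa [hy, norm_conj]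
  have hne : 1 - z ≠ 0 := hz ▸ one_sub_mul_exp_ne_zero hq0 hq1 x
  have hne' : 1 - y ≠ 0 := by
    have := (map_ne_zero (starRingEnd ℂ)).mpr hne
    rwa [map_sub, map_one, ← hy] at this
  have hsq : ((‖1 - z‖ ^ 2 : ℝ) : ℂ) = (1 - z) * (1 - y) := by
    rw [← normSq_eq_norm_sq, ← mul_conj, map_sub, map_one, ← hy]
  have hzy : z * y = (q : ℂ) ^ 2 := by
    rw [hyq, hz, mul_mul_mul_comm, ← exp_add, add_neg_cancel, exp_zero, mul_one, sq]
  -- Geometric series for `k ≥ 0` in `z` and for `k < 0` in its conjugate `y`.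
  have hval : (((1 - q ^ 2) / ‖1 - z‖ ^ 2 : ℝ) : ℂ) = (1 - z)⁻¹ + y * (1 - y)⁻¹ := by
    rw [ofReal_div, hsq, ofReal_sub, ofReal_pow, ofReal_one, ← hzy]
    field_simp
    ring
  rw [← hz, hval]
  refine HasSum.of_nat_of_neg_add_one
    (hasSum_of_forall_eq (fun n => ?_) (hasSum_geometric_of_norm_lt_one hzn))
    (hasSum_of_forall_eq (fun n => ?_) ((hasSum_geometric_of_norm_lt_one hyn).mul_left y))
  · rw [hz, mul_pow, ← exp_nat_mul, Int.natAbs_natCast, Int.cast_natCast, mul_assoc (n : ℂ)]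
  · have : (-((n : ℤ) + 1)).natAbs = n + 1 := by omega
    rw [← pow_succ', hyq, mul_pow, ← exp_nat_mul, this]
    congr 2
    push_cast
    ring

/-- Termwise integration against the Poisson kernel. -/
theorem hasSum_integral_mul_poisson {q : ℝ} (hq0 : 0 ≤ q) (hq1 : q < 1) {h : ℝ → ℂ}
    (hc : Continuous h) {B : ℝ} (hB : ∀ s, ‖h s‖ ≤ B) (θ : ℝ) :
    HasSum (fun k : ℤ => ∫ s in (0 : ℝ)..2 * Real.pi,
        h s * ((q : ℂ) ^ k.natAbs * exp (k * (θ - s : ℝ) * I)))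
      (∫ s in (0 : ℝ)..2 * Real.pi,
        h s * (((1 - q ^ 2) / ‖1 - (q : ℂ) * exp ((θ - s : ℝ) * I)‖ ^ 2 : ℝ) : ℂ)) := by
  refine intervalIntegral.hasSum_integral_of_dominated_convergence
    (fun (k : ℤ) _ => B * q ^ k.natAbs) ?_ ?_ ?_ ?_ ?_
  · intro k
    exact (by fun_prop : Continuous fun s : ℝ =>
      h s * ((q : ℂ) ^ k.natAbs * exp (k * (θ - s : ℝ) * I))).aestronglyMeasurable
  · intro k
    refine Filter.Eventually.of_forall fun s _ => ?_
    have : (k : ℂ) * (θ - s : ℝ) * I = ((k * (θ - s) : ℝ) : ℂ) * I := by push_cast; ring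
    rw [norm_mul, norm_mul, this, norm_exp_ofReal_mul_I, mul_one, norm_pow, norm_real,
      Real.norm_of_nonneg hq0]
    exact mul_le_mul_of_nonneg_right (hB s) (by positivity)
  · exact Filter.Eventually.of_forall fun s _ => (summable_pow_natAbs hq0 hq1).mul_left B
  · exact intervalIntegrable_const
  · exact Filter.Eventually.of_forall fun s _ => (hasSum_poisson hq0 hq1 (θ - s)).mul_left _

theorem integral_exp_int_mul {k : ℤ} (hk : k ≠ 0) (θ : ℝ) :
    ∫ s in (0 : ℝ)..2 * Real.pi, exp (k * (θ - s : ℝ) * I) = 0 := by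
  have hne : (-(k * I) : ℂ) ≠ 0 := by simp [hk]
  have h1 : ∀ s : ℝ, exp (k * (θ - s : ℝ) * I) = exp (k * θ * I) * exp (-(k * I) * s) := by
    intro s
    rw [← exp_add]
    congr 1
    push_cast
    ring
  simp only [h1]
  rw [intervalIntegral.integral_const_mul, integral_exp_mul_complex hne]
  have h2 : exp (-(k * I) * ((2 * Real.pi : ℝ) : ℂ)) = 1 := by
    rw [exp_eq_one_iff]
    exact ⟨-k, by push_cast; ring⟩
  rw [h2]
  simp

theorem integral_poisson {q : ℝ} (hq0 : 0 ≤ q) (hq1 : q < 1) (θ : ℝ) :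
    ∫ s in (0 : ℝ)..2 * Real.pi, (1 - q ^ 2) / ‖1 - (q : ℂ) * exp ((θ - s : ℝ) * I)‖ ^ 2 =
      2 * Real.pi := by
  have h1 := hasSum_integral_mul_poisson hq0 hq1 (h := fun _ => 1) continuous_const (B := 1)
    (by simp) θ
  have h2 : HasSum (fun k : ℤ => ∫ s in (0 : ℝ)..2 * Real.pi,
      (1 : ℂ) * ((q : ℂ) ^ k.natAbs * exp (k * (θ - s : ℝ) * I))) ((2 * Real.pi : ℝ) : ℂ) := by
    convert hasSum_single (f := fun k : ℤ => ∫ s in (0 : ℝ)..2 * Real.pi,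
      (1 : ℂ) * ((q : ℂ) ^ k.natAbs * exp (k * (θ - s : ℝ) * I))) 0 ?_ using 1
    · simp
    · intro k hk
      simp only [one_mul]
      rw [intervalIntegral.integral_const_mul, integral_exp_int_mul hk, mul_zero]
  have h3 := h1.unique h2
  simp only [one_mul] at h3
  rw [intervalIntegral.integral_ofReal] at h3
  exact_mod_cast h3

/-- The Poisson means of a bounded function are bounded by the same constant. -/
theorem exists_hasSum_poisson_mean {q : ℝ} (hq0 : 0 ≤ q) (hq1 : q < 1) {h : ℝ → ℂ}
    (hc : Continuous h) {B : ℝ} (hB : ∀ s, ‖h s‖ ≤ B) (θ : ℝ) :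
    ∃ U : ℂ, HasSum (fun k : ℤ => (q : ℂ) ^ k.natAbs * circleCoeff h k * exp (k * θ * I)) U ∧
      ‖U‖ ≤ B := by
  have h1 := (hasSum_integral_mul_poisson hq0 hq1 hc hB θ).mul_left ((2 * Real.pi : ℂ)⁻¹)
  refine ⟨_, hasSum_of_forall_eq (fun k => ?_) h1, ?_⟩
  · have : ∀ s : ℝ, h s * ((q : ℂ) ^ k.natAbs * exp (k * (θ - s : ℝ) * I)) =
        (q : ℂ) ^ k.natAbs * exp (k * θ * I) * (h s * exp (-(k * s * I))) := by
      intro s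
      have : exp (k * (θ - s : ℝ) * I) = exp (k * θ * I) * exp (-(k * s * I)) := by
        rw [← exp_add]
        congr 1
        push_cast
        ring
      rw [this]
      ring
    simp only [this]
    rw [intervalIntegral.integral_const_mul, circleCoeff]
    ring
  · have hpi : (0 : ℝ) ≤ 2 * Real.pi := by positivity
    have hP : Continuous fun s : ℝ =>
        (1 - q ^ 2) / ‖1 - (q : ℂ) * exp ((θ - s : ℝ) * I)‖ ^ 2 := by
      refine Continuous.div (by fun_prop) (by fun_prop) fun s => ?_
      exact pow_ne_zero _ (norm_ne_zero_iff.mpr (one_sub_mul_exp_ne_zero hq0 hq1 _))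
    have hP0 : ∀ s : ℝ, 0 ≤ (1 - q ^ 2) / ‖1 - (q : ℂ) * exp ((θ - s : ℝ) * I)‖ ^ 2 := by
      intro s
      have : 0 ≤ 1 - q ^ 2 := by nlinarith
      positivity
    have h2 : ‖∫ s in (0 : ℝ)..2 * Real.pi,
        h s * (((1 - q ^ 2) / ‖1 - (q : ℂ) * exp ((θ - s : ℝ) * I)‖ ^ 2 : ℝ) : ℂ)‖ ≤
        B * (2 * Real.pi) := by
      have hBP := intervalIntegral.integral_const_mul (μ := volume) (a := 0) (b := 2 * Real.pi) B
        fun s : ℝ => (1 - q ^ 2) / ‖1 - (q : ℂ) * exp ((θ - s : ℝ) * I)‖ ^ 2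
      rw [integral_poisson hq0 hq1 θ] at hBP
      refine le_of_le_of_eq ?_ hBP
      refine intervalIntegral.norm_integral_le_of_norm_le hpi
        (Filter.Eventually.of_forall fun s _ => ?_)
        ((continuous_const.mul hP).intervalIntegrable _ _)
      rw [norm_mul, norm_real, Real.norm_of_nonneg (hP0 s)]
      exact mul_le_mul_of_nonneg_right (hB s) (hP0 s)
    have h3 : ‖(2 * Real.pi : ℂ)⁻¹‖ = (2 * Real.pi)⁻¹ := by
      rw [norm_inv]
      congr 1
      have : (2 * Real.pi : ℂ) = ((2 * Real.pi : ℝ) : ℂ) := by push_cast; ring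
      rw [this, norm_real, Real.norm_of_nonneg hpi]
    rw [norm_mul, h3]
    calc _ ≤ (2 * Real.pi)⁻¹ * (B * (2 * Real.pi)) := by gcongr
      _ = B := by field_simp

theorem circleCoeff_mul_exp (h : ℝ → ℂ) (n k : ℤ) :
    circleCoeff (fun s => h s * exp (-(n * s * I))) k = circleCoeff h (k + n) := by
  unfold circleCoeff
  congr 2
  ext s
  rw [mul_assoc, ← exp_add]
  congr 2
  push_cast
  ring

/-- Modulating `h` by a character shifts its coefficients by `n` and preserves its modulus, so the
Poisson bound carries over. -/
theorem exists_hasSum_shifted_poisson_mean {q : ℝ} (hq0 : 0 ≤ q) (hq1 : q < 1) {h : ℝ → ℂ}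
    (hc : Continuous h) {B : ℝ} (hB : ∀ s, ‖h s‖ ≤ B) (n : ℤ) (θ : ℝ) :
    ∃ U : ℂ, HasSum (fun k : ℤ => (q : ℂ) ^ (k - n).natAbs * circleCoeff h k * exp (k * θ * I)) U ∧
      ‖U‖ ≤ B := by
  have hn : ∀ s : ℝ, ‖exp (n * s * I)‖ = 1 := by
    intro s
    have : (n : ℂ) * s * I = ((n * s : ℝ) : ℂ) * I := by push_cast; ring
    rw [this, norm_exp_ofReal_mul_I]
  obtain ⟨U, hU, hUB⟩ := exists_hasSum_poisson_mean hq0 hq1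
    (h := fun s => h s * exp (-(n * s * I))) (by fun_prop) (B := B)
    (fun s => by rw [norm_mul, exp_neg, norm_inv, hn, inv_one, mul_one]; exact hB s) θ
  refine ⟨exp (n * θ * I) * U, ?_, by rw [norm_mul, hn, one_mul]; exact hUB⟩
  have h1 := (Equiv.subRight n).hasSum_iff.mpr (hU.mul_left (exp (n * θ * I)))
  refine hasSum_of_forall_eq (fun k => ?_) h1
  simp only [Function.comp_apply, Equiv.subRight_apply, circleCoeff_mul_exp, sub_add_cancel]
  have : exp (k * θ * I) = exp (n * θ * I) * exp ((k - n : ℤ) * θ * I) := by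
    rw [← exp_add]
    congr 1
    push_cast
    ring
  rw [this]
  ring

/-- A multiplier that agrees with `q ^ |k|` for `|k| ≥ n` and has small norm. -/
noncomputable def tailWeight (q : ℝ) (n : ℕ) (k : ℤ) : ℝ :=
  (q ^ (k - n).natAbs + q ^ (k + n).natAbs) / (q ^ n + (q ^ n)⁻¹)

/-- Here `|k - n|` and `|k + n|` are `|k| - n` and `|k| + n` in some order, so `q ^ |k|` factors out
of the numerator. -/
theorem tailWeight_eq {q : ℝ} (hq0 : 0 < q) {n : ℕ} {k : ℤ} (hk : n ≤ k.natAbs) :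
    tailWeight q n k = q ^ k.natAbs := by
  have hpos : 0 < q ^ n + (q ^ n)⁻¹ := by positivity
  rw [tailWeight, div_eq_iff hpos.ne']
  obtain ⟨m, hm⟩ := Nat.exists_eq_add_of_le hk
  have key : q ^ (k.natAbs - n) + q ^ (k.natAbs + n) =
      q ^ k.natAbs * (q ^ n + (q ^ n)⁻¹) := by
    rw [hm, Nat.add_sub_cancel_left, pow_add, pow_add]
    have : q ^ n ≠ 0 := by positivity
    field_simp
    ring
  rcases le_total 0 k with h | h
  · rw [← key]
    congr 2 <;> omega
  · rw [← key, add_comm]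
    congr 2 <;> omega

theorem exists_hasSum_tailWeight {q : ℝ} (hq0 : 0 < q) (hq1 : q < 1) {h : ℝ → ℂ}
    (hc : Continuous h) {B : ℝ} (hB : ∀ s, ‖h s‖ ≤ B) (n : ℕ) (θ : ℝ) :
    ∃ U : ℂ, HasSum (fun k : ℤ => (tailWeight q n k : ℂ) * circleCoeff h k * exp (k * θ * I)) U ∧
      ‖U‖ ≤ 2 * q ^ n * B := by
  obtain ⟨U, hU, hUB⟩ := exists_hasSum_shifted_poisson_mean hq0.le hq1 hc hB n θ
  obtain ⟨V, hV, hVB⟩ := exists_hasSum_shifted_poisson_mean hq0.le hq1 hc hB (-n) θ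
  have hB0 : 0 ≤ B := (norm_nonneg _).trans hUB
  set d : ℝ := q ^ n + (q ^ n)⁻¹ with hd
  have hdpos : 0 < d := by positivity
  refine ⟨((d⁻¹ : ℝ) : ℂ) * (U + V), ?_, ?_⟩
  · refine hasSum_of_forall_eq (fun k => ?_) ((hU.add hV).mul_left ((d⁻¹ : ℝ) : ℂ))
    rw [tailWeight, ← hd, sub_neg_eq_add]
    push_cast
    ring
  · have h1 : d⁻¹ ≤ q ^ n := by
      rw [inv_le_comm₀ hdpos (by positivity), hd]
      linarith [pow_pos hq0 n]
    rw [norm_mul, norm_real, Real.norm_of_nonneg (by positivity)]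
    calc d⁻¹ * ‖U + V‖ ≤ q ^ n * (B + B) := by
          gcongr
          exact (norm_add_le _ _).trans (add_le_add hUB hVB)
      _ = _ := by ring

end ExpCone

/-! ### The Joukowski map and the Bernstein ellipse. -/

namespace ExpCone

open Complex

/-- The Joukowski map. -/
noncomputable def joukowski (w : ℂ) : ℂ := (w + w⁻¹) / 2

theorem norm_joukowski_sub_add_norm {w : ℂ} (hw : w ≠ 0) :
    ‖joukowski w - 1‖ + ‖joukowski w + 1‖ = ‖w‖ + ‖w‖⁻¹ := by
  have h1 : joukowski w - 1 = (w - 1) ^ 2 / (2 * w) := by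
    rw [joukowski]; field_simp; ring
  have h2 : joukowski w + 1 = (w + 1) ^ 2 / (2 * w) := by
    rw [joukowski]; field_simp; ring
  have h3 := parallelogram_law_with_norm ℝ w 1
  rw [norm_one] at h3
  have hn : ‖w‖ ≠ 0 := norm_ne_zero_iff.mpr hw
  rw [h1, h2, norm_div, norm_div, norm_pow, norm_pow, norm_mul, Complex.norm_ofNat]
  field_simp
  linarith

/-- Take `w = z + √(z² - 1)`, whose inverse is `z - √(z² - 1)`. -/
theorem exists_joukowski_eq (z : ℂ) : ∃ w : ℂ, w ≠ 0 ∧ joukowski w = z := by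
  obtain ⟨s, hs⟩ := IsAlgClosed.exists_pow_nat_eq (z ^ 2 - 1) (n := 2) (by norm_num)
  have h1 : (z + s) * (z - s) = 1 := by linear_combination -hs
  refine ⟨z + s, left_ne_zero_of_mul_eq_one h1, ?_⟩
  rw [joukowski, inv_eq_of_mul_eq_one_right h1]
  ring

theorem joukowski_inv (w : ℂ) : joukowski w⁻¹ = joukowski w := by
  rw [joukowski, joukowski, inv_inv, add_comm]

theorem bernsteinPoint_eq_joukowski (ρ θ : ℝ) :
    bernsteinPoint ρ θ = joukowski (ρ * exp (θ * I)) := by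
  rw [bernsteinPoint, joukowski, mul_inv, ← exp_neg, mul_comm I]
  ring

theorem add_inv_sub_add_inv {r ρ : ℝ} (hr : r ≠ 0) (hρ : ρ ≠ 0) :
    (ρ + ρ⁻¹) - (r + r⁻¹) = (ρ - r) * (1 - r⁻¹ * ρ⁻¹) := by
  field_simp
  ring

theorem exists_bernsteinPoint_eq {ρ : ℝ} (hρ : 1 < ρ) {z : ℂ}
    (hz : ‖z - 1‖ + ‖z + 1‖ = ρ + ρ⁻¹) :
    ∃ θ ∈ Set.Icc (0 : ℝ) (2 * Real.pi), bernsteinPoint ρ θ = z := by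
  have hρ0 : 0 < ρ := by linarith
  obtain ⟨w, hw, hwn, hwz⟩ : ∃ w : ℂ, w ≠ 0 ∧ ‖w‖ = ρ ∧ joukowski w = z := by
    obtain ⟨w, hw, rfl⟩ := exists_joukowski_eq z
    rw [norm_joukowski_sub_add_norm hw] at hz
    have hn : ‖w‖ ≠ 0 := norm_ne_zero_iff.mpr hw
    have h := add_inv_sub_add_inv hn hρ0.ne'
    -- So `‖w‖` is `ρ` or `ρ⁻¹`; in the second case `w⁻¹` serves.
    rw [hz, sub_self, eq_comm, mul_eq_zero] at h
    rcases h with h | h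
    · exact ⟨w, hw, by linarith, rfl⟩
    · refine ⟨w⁻¹, inv_ne_zero hw, ?_, joukowski_inv w⟩
      rw [norm_inv]
      field_simp at h ⊢
      linarith
  have hpi := Real.pi_pos
  have hpolar := norm_mul_exp_arg_mul_I w
  rw [hwn] at hpolar
  rcases le_or_gt 0 (arg w) with h | h
  · refine ⟨arg w, ⟨h, by linarith [arg_le_pi w]⟩, ?_⟩
    rw [bernsteinPoint_eq_joukowski, hpolar, hwz]
  · refine ⟨arg w + 2 * Real.pi, ⟨by linarith [neg_pi_lt_arg w], by linarith⟩, ?_⟩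
    have : exp ((arg w + 2 * Real.pi : ℝ) * I) = exp (arg w * I) := by
      push_cast
      exact exp_mul_I_periodic _
    rw [bernsteinPoint_eq_joukowski, this, hpolar, hwz]

theorem isOpen_bernsteinRegion (ρ : ℝ) : IsOpen (bernsteinRegion ρ) :=
  isOpen_lt (by fun_prop) continuous_const

theorem isBounded_bernsteinRegion (ρ : ℝ) : Bornology.IsBounded (bernsteinRegion ρ) := by
  refine (Metric.isBounded_closedBall (x := (0 : ℂ)) (r := ρ + ρ⁻¹)).subset fun z hz => ?_
  have h : ‖z - 1‖ + ‖z + 1‖ < ρ + ρ⁻¹ := hz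
  have h2 : ‖(2 : ℂ) * z‖ ≤ ‖z - 1‖ + ‖z + 1‖ := by
    have : (2 : ℂ) * z = (z - 1) + (z + 1) := by ring
    rw [this]
    exact norm_add_le _ _
  rw [norm_mul, Complex.norm_ofNat] at h2
  rw [mem_closedBall_zero_iff]
  linarith [norm_nonneg z]

/-- Maximum principle on the region bounded by a Bernstein ellipse. -/
theorem norm_le_of_mem_bernsteinRegion {ρ L : ℝ} (hρ : 1 < ρ) {F : ℂ → ℂ}
    (hF : DiffContOnCl ℂ F (bernsteinRegion ρ))
    (hL : ∀ θ ∈ Set.Icc (0 : ℝ) (2 * Real.pi), ‖F (bernsteinPoint ρ θ)‖ ≤ L)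
    {z : ℂ} (hz : z ∈ bernsteinRegion ρ) : ‖F z‖ ≤ L := by
  refine norm_le_of_forall_mem_frontier_norm_le (isBounded_bernsteinRegion ρ) hF (fun y hy => ?_)
    (subset_closure hz)
  have hy' : ‖y - 1‖ + ‖y + 1‖ = ρ + ρ⁻¹ :=
    frontier_lt_subset_eq (f := fun z : ℂ => ‖z - 1‖ + ‖z + 1‖) (g := fun _ => ρ + ρ⁻¹)
      (by fun_prop) continuous_const hy
  obtain ⟨θ, hθ, rfl⟩ := exists_bernsteinPoint_eq hρ hy'
  exact hL θ hθ

/-- The gap between `r` and `r ^ 2` puts the closed annulus inside the open region, where the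
extension is differentiable. -/
theorem joukowski_mem_bernsteinRegion {r : ℝ} (hr : 1 < r) {w : ℂ} (h1 : r⁻¹ ≤ ‖w‖)
    (h2 : ‖w‖ ≤ r) : joukowski w ∈ bernsteinRegion (r ^ 2) := by
  have hr0 : 0 < r := by linarith
  have hw0 : 0 < ‖w‖ := (inv_pos.mpr hr0).trans_le h1
  have hw : w ≠ 0 := norm_pos_iff.mp hw0
  change ‖joukowski w - 1‖ + ‖joukowski w + 1‖ < r ^ 2 + (r ^ 2)⁻¹
  rw [norm_joukowski_sub_add_norm hw, ← sub_pos,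
    add_inv_sub_add_inv hw0.ne' (by positivity)]
  have h3 : ‖w‖⁻¹ ≤ r := inv_le_of_inv_le₀ hr0 h1
  have h4 : r < r ^ 2 := by nlinarith
  have h5 : ‖w‖⁻¹ * (r ^ 2)⁻¹ < 1 := by
    rw [← div_eq_mul_inv, div_lt_one (by positivity)]
    linarith
  exact mul_pos (by linarith) (by linarith)

/-! ### Trigonometric approximation of functions analytic on an annulus. -/

section Annulus

variable {g : ℂ → ℂ} {r L : ℝ}

theorem continuous_comp_circle (hd : ∀ w : ℂ, r⁻¹ ≤ ‖w‖ → ‖w‖ ≤ r → DifferentiableAt ℂ g w) {s : ℝ}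
    (h0 : 0 ≤ s) (h1 : r⁻¹ ≤ s) (h2 : s ≤ r) : Continuous fun θ : ℝ => g (s * exp (θ * I)) := by
  rw [continuous_iff_continuousAt]
  intro θ
  have hn : ‖(s : ℂ) * exp (θ * I)‖ = s := by
    rw [norm_mul, norm_exp_ofReal_mul_I, mul_one, norm_real, Real.norm_of_nonneg h0]
  exact ContinuousAt.comp (f := fun θ : ℝ => (s : ℂ) * exp (θ * I)) (g := g)
    (hd _ (by rw [hn]; exact h1) (by rw [hn]; exact h2)).continuousAt
    (by fun_prop : Continuous fun θ : ℝ => (s : ℂ) * exp (θ * I)).continuousAt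

/-- Cauchy's theorem on the annulus for `z ^ (-k) * g z` against `dz / z`. -/
theorem zpow_mul_circleCoeff (hd : ∀ w : ℂ, r⁻¹ ≤ ‖w‖ → ‖w‖ ≤ r → DifferentiableAt ℂ g w)
    {s s' : ℝ} (h0 : 0 < s) (h1 : r⁻¹ ≤ s) (h2 : s ≤ s') (h3 : s' ≤ r) (k : ℤ) :
    (s' : ℂ) ^ (-k) * circleCoeff (fun θ => g (s' * exp (θ * I))) k =
      (s : ℂ) ^ (-k) * circleCoeff (fun θ => g (s * exp (θ * I))) k := by
  have hdiff : ∀ z : ℂ, s ≤ ‖z‖ → ‖z‖ ≤ s' → DifferentiableAt ℂ (fun z => z ^ (-k) * g z) z := by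
    intro z hz1 hz2
    refine DifferentiableAt.mul ?_ (hd z (h1.trans hz1) (hz2.trans h3))
    exact differentiableAt_zpow.mpr (Or.inl (norm_pos_iff.mp (h0.trans_le hz1)))
  have h := circleIntegral_sub_center_inv_smul_eq_of_differentiable_on_annulus_off_countable
    (c := 0) h0 h2 (f := fun z => z ^ (-k) * g z) Set.countable_empty
    (fun z hz => by
      simp only [Set.mem_sdiff, mem_closedBall_zero_iff, mem_ball_zero_iff, not_lt] at hz
      exact (hdiff z hz.2 hz.1).continuousAt.continuousWithinAt)
    (fun z hz => by
      simp only [Set.mem_sdiff, mem_closedBall_zero_iff, mem_ball_zero_iff, not_le,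
        Set.mem_empty_iff_false, not_false_eq_true, and_true] at hz
      exact hdiff z hz.2.le hz.1.le)
  have key : ∀ R : ℝ, 0 < R → (∮ z in C(0, R), (z - 0)⁻¹ • (z ^ (-k) * g z)) =
      I * (2 * Real.pi) * ((R : ℂ) ^ (-k) * circleCoeff (fun θ => g (R * exp (θ * I))) k) := by
    intro R hR
    have hterm : ∀ θ : ℝ, deriv (circleMap 0 R) θ • ((circleMap 0 R θ - 0)⁻¹ •
        ((circleMap 0 R θ) ^ (-k) * g (circleMap 0 R θ))) =
        I * (R : ℂ) ^ (-k) * (g (R * exp (θ * I)) * exp (-(k * θ * I))) := by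
      intro θ
      have hne : (R : ℂ) * exp (θ * I) ≠ 0 :=
        mul_ne_zero (ofReal_ne_zero.mpr hR.ne') (exp_ne_zero _)
      have hexp : exp (θ * I) ^ (-k) = exp (-(k * θ * I)) := by
        rw [← exp_int_mul]
        congr 1
        push_cast
        ring
      rw [deriv_circleMap, circleMap_zero, sub_zero, smul_eq_mul, smul_eq_mul, mul_zpow, hexp,
        mul_comm _ I, ← mul_assoc, mul_assoc I, mul_inv_cancel₀ hne]
      ring
    rw [circleIntegral, intervalIntegral.integral_congr fun θ _ => hterm θ,
      intervalIntegral.integral_const_mul, circleCoeff]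
    have hpi : (2 * Real.pi : ℂ) ≠ 0 := by simp
    generalize (∫ θ in (0 : ℝ)..2 * Real.pi, g (R * exp (θ * I)) * exp (-(k * θ * I))) = J
    field_simp
  rw [key _ (h0.trans_le h2), key _ h0] at h
  exact mul_left_cancel₀ (mul_ne_zero I_ne_zero (by simp)) h

theorem circleCoeff_circle (hr : 1 < r)
    (hd : ∀ w : ℂ, r⁻¹ ≤ ‖w‖ → ‖w‖ ≤ r → DifferentiableAt ℂ g w)
    {s : ℝ} (h0 : 0 < s) (h1 : r⁻¹ ≤ s) (h2 : s ≤ r) (k : ℤ) :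
    circleCoeff (fun θ => g (s * exp (θ * I))) k =
      (s : ℂ) ^ k * circleCoeff (fun θ => g (exp (θ * I))) k := by
  have hs : (s : ℂ) ≠ 0 := ofReal_ne_zero.mpr h0.ne'
  have hone : ((1 : ℝ) : ℂ) ^ (-k) * circleCoeff (fun θ => g (((1 : ℝ) : ℂ) * exp (θ * I))) k =
      circleCoeff (fun θ => g (exp (θ * I))) k := by simp
  have h : (s : ℂ) ^ (-k) * circleCoeff (fun θ => g (s * exp (θ * I))) k =
      circleCoeff (fun θ => g (exp (θ * I))) k := by
    rw [← hone]
    rcases le_total 1 s with h | h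
    · exact zpow_mul_circleCoeff hd one_pos (inv_le_one_of_one_le₀ hr.le) h h2 k
    · exact (zpow_mul_circleCoeff hd h0 h1 h hr.le k).symm
  rw [← h, ← mul_assoc, ← zpow_add₀ hs, add_neg_cancel, zpow_zero, one_mul]

theorem norm_circleCoeff_le {h : ℝ → ℂ} {B : ℝ} (hB : ∀ s, ‖h s‖ ≤ B) (k : ℤ) :
    ‖circleCoeff h k‖ ≤ B := by
  have hpi : (0 : ℝ) < 2 * Real.pi := by positivity
  have h1 : ‖∫ s in (0 : ℝ)..2 * Real.pi, h s * exp (-(k * s * I))‖ ≤ B * |2 * Real.pi - 0| := by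
    refine intervalIntegral.norm_integral_le_of_norm_le_const fun s _ => ?_
    have : -((k : ℂ) * s * I) = ((-(k * s) : ℝ) : ℂ) * I := by push_cast; ring
    rw [norm_mul, this, norm_exp_ofReal_mul_I, mul_one]
    exact hB s
  have h2 : (2 * Real.pi : ℂ) = ((2 * Real.pi : ℝ) : ℂ) := by push_cast; ring
  rw [circleCoeff, norm_mul, norm_inv, h2, norm_real, Real.norm_of_nonneg hpi.le,
    inv_mul_le_iff₀ hpi]
  rw [sub_zero, abs_of_pos hpi] at h1
  linarith

theorem norm_comp_circle_le (hL : ∀ w : ℂ, r⁻¹ ≤ ‖w‖ → ‖w‖ ≤ r → ‖g w‖ ≤ L) {s : ℝ}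
    (h0 : 0 ≤ s) (h1 : r⁻¹ ≤ s) (h2 : s ≤ r) (θ : ℝ) : ‖g (s * exp (θ * I))‖ ≤ L := by
  have hn : ‖(s : ℂ) * exp (θ * I)‖ = s := by
    rw [norm_mul, norm_exp_ofReal_mul_I, mul_one, norm_real, Real.norm_of_nonneg h0]
  exact hL _ (by rw [hn]; exact h1) (by rw [hn]; exact h2)

/-- Cauchy estimates, on the outer circle for `k ≥ 0` and the inner one for `k ≤ 0`. They serve only
to make the Fourier series summable. -/
theorem norm_circleCoeff_unit_le (hr : 1 < r)
    (hd : ∀ w : ℂ, r⁻¹ ≤ ‖w‖ → ‖w‖ ≤ r → DifferentiableAt ℂ g w)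
    (hL : ∀ w : ℂ, r⁻¹ ≤ ‖w‖ → ‖w‖ ≤ r → ‖g w‖ ≤ L) (k : ℤ) :
    ‖circleCoeff (fun θ => g (exp (θ * I))) k‖ ≤ L * r⁻¹ ^ k.natAbs := by
  have hr0 : 0 < r := by linarith
  have hi : r⁻¹ ≤ r := (inv_le_one_of_one_le₀ hr.le).trans hr.le
  have hL0 : 0 ≤ L := (norm_nonneg _).trans (norm_comp_circle_le hL hr0.le hi le_rfl 0)
  have key : ∀ s : ℝ, 0 < s → r⁻¹ ≤ s → s ≤ r → s ^ k = r ^ k.natAbs →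
      ‖circleCoeff (fun θ => g (exp (θ * I))) k‖ ≤ L * r⁻¹ ^ k.natAbs := by
    intro s h0 h1 h2 hs
    have h := norm_circleCoeff_le (norm_comp_circle_le hL h0.le h1 h2) k
    rw [circleCoeff_circle hr hd h0 h1 h2, norm_mul, norm_zpow, norm_real,
      Real.norm_of_nonneg h0.le, hs] at h
    rw [inv_pow, ← div_eq_mul_inv, le_div_iff₀ (by positivity)]
    linarith
  rcases le_total 0 k with hk | hk
  · refine key r hr0 hi le_rfl ?_
    conv_lhs => rw [← Int.natAbs_of_nonneg hk]
    exact zpow_natCast _ _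
  · refine key r⁻¹ (by positivity) le_rfl hi ?_
    have : k = -(k.natAbs : ℤ) := by omega
    conv_lhs => rw [this]
    rw [inv_zpow', neg_neg, zpow_natCast]

theorem hasSum_circleCoeff (hr : 1 < r)
    (hd : ∀ w : ℂ, r⁻¹ ≤ ‖w‖ → ‖w‖ ≤ r → DifferentiableAt ℂ g w)
    (hL : ∀ w : ℂ, r⁻¹ ≤ ‖w‖ → ‖w‖ ≤ r → ‖g w‖ ≤ L) (θ : ℝ) :
    HasSum (fun k : ℤ => circleCoeff (fun θ => g (exp (θ * I))) k * exp (k * θ * I))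
      (g (exp (θ * I))) := by
  have hr0 : 0 < r := by linarith
  have : Fact (0 < 2 * Real.pi) := ⟨by positivity⟩
  let f : C(AddCircle (2 * Real.pi), ℂ) :=
    ⟨fun x => g (AddCircle.toCircle x), by
      rw [continuous_iff_continuousAt]
      intro x
      refine ContinuousAt.comp (f := fun x : AddCircle (2 * Real.pi) => (AddCircle.toCircle x : ℂ))
        (hd _ ?_ ?_).continuousAt
        (continuous_subtype_val.comp AddCircle.continuous_toCircle).continuousAt
      · rw [Circle.norm_coe]; exact inv_le_one_of_one_le₀ hr.le
      · rw [Circle.norm_coe]; exact hr.le⟩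
  have hf : ∀ x : ℝ, f (x : AddCircle (2 * Real.pi)) = g (exp (x * I)) := by
    intro x
    have hpi : 2 * Real.pi / (2 * Real.pi) * x = x := by field_simp
    change g (AddCircle.toCircle (x : AddCircle (2 * Real.pi))) = _
    rw [AddCircle.toCircle_apply_mk, hpi, Circle.coe_exp]
  have hfour : ∀ (k : ℤ) (x : ℝ), fourier k (x : AddCircle (2 * Real.pi)) = exp (k * x * I) := by
    intro k x
    have hpi : (Real.pi : ℂ) ≠ 0 := ofReal_ne_zero.mpr Real.pi_ne_zero
    rw [fourier_coe_apply]
    congr 1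
    push_cast
    field_simp
  have hcoef : ∀ k : ℤ, fourierCoeff f k = circleCoeff (fun θ => g (exp (θ * I))) k := by
    intro k
    rw [fourierCoeff_eq_intervalIntegral f k 0, circleCoeff, zero_add, one_div, real_smul]
    push_cast
    congr 1
    refine intervalIntegral.integral_congr fun x _ => ?_
    rw [hf, hfour, smul_eq_mul, mul_comm]
    congr 2
    push_cast
    ring
  have hsum : Summable (fourierCoeff f) := by
    refine Summable.of_norm_bounded
      ((summable_pow_natAbs (q := r⁻¹) (by positivity) (inv_lt_one_of_one_lt₀ hr)).mul_left L)
      fun k => ?_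
    rw [hcoef]
    exact norm_circleCoeff_unit_le hr hd hL k
  have h := has_pointwise_sum_fourier_series_of_summable hsum (θ : AddCircle (2 * Real.pi))
  rw [hf] at h
  refine hasSum_of_forall_eq (fun k => ?_) h
  rw [hcoef, hfour, smul_eq_mul]

theorem circleCoeff_add {h₁ h₂ : ℝ → ℂ} (hc₁ : Continuous h₁) (hc₂ : Continuous h₂) (k : ℤ) :
    circleCoeff (fun s => h₁ s + h₂ s) k = circleCoeff h₁ k + circleCoeff h₂ k := by
  simp only [circleCoeff, add_mul]
  rw [intervalIntegral.integral_add, mul_add]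
  · exact (by fun_prop : Continuous fun s : ℝ => h₁ s * exp (-(k * s * I))).intervalIntegrable _ _
  · exact (by fun_prop : Continuous fun s : ℝ => h₂ s * exp (-(k * s * I))).intervalIntegrable _ _

/-- A function bounded by `L` and analytic in an annulus is approximated on the unit circle by
trigonometric polynomials of degree less than `n` up to `6 L r⁻ⁿ`. -/
theorem exists_trigPoly_approx (hr : 1 < r)
    (hd : ∀ w : ℂ, r⁻¹ ≤ ‖w‖ → ‖w‖ ≤ r → DifferentiableAt ℂ g w)
    (hL : ∀ w : ℂ, r⁻¹ ≤ ‖w‖ → ‖w‖ ≤ r → ‖g w‖ ≤ L) (n : ℕ) :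
    ∃ d : ℤ → ℂ, ∀ θ : ℝ,
      ‖g (exp (θ * I)) - ∑ k ∈ Finset.Ioo (-(n : ℤ)) n, d k * exp (k * θ * I)‖ ≤
        6 * L * r⁻¹ ^ n := by
  have hr0 : 0 < r := by linarith
  have hq0 : 0 < r⁻¹ := by positivity
  have hq1 : r⁻¹ < 1 := inv_lt_one_of_one_lt₀ hr
  have hi : r⁻¹ ≤ r := hq1.le.trans hr.le
  have hL0 : 0 ≤ L := (norm_nonneg _).trans (norm_comp_circle_le hL hr0.le hi le_rfl 0)
  have hc₁ := continuous_comp_circle hd hr0.le hi le_rfl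
  have hc₂ := continuous_comp_circle hd hq0.le le_rfl hi
  have hc₀ : Continuous fun θ : ℝ => g (exp (θ * I)) := by
    simpa using continuous_comp_circle hd zero_le_one hq1.le hr.le
  have hB₀ : ∀ θ : ℝ, ‖g (exp (θ * I))‖ ≤ L := by
    simpa using norm_comp_circle_le hL zero_le_one hq1.le hr.le
  let c : ℤ → ℂ := circleCoeff fun θ => g (exp (θ * I))
  let h : ℝ → ℂ := fun θ => g (r * exp (θ * I)) + g ((r⁻¹ : ℝ) * exp (θ * I))
  have hhc : ∀ k, circleCoeff h k = ((r : ℂ) ^ k + ((r⁻¹ : ℝ) : ℂ) ^ k) * c k := by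
    intro k
    rw [circleCoeff_add hc₁ hc₂, circleCoeff_circle hr hd hr0 hi le_rfl,
      circleCoeff_circle hr hd hq0 le_rfl hi, add_mul]
  have hhB : ∀ θ, ‖h θ‖ ≤ 2 * L := by
    intro θ
    refine (norm_add_le _ _).trans ?_
    linarith [norm_comp_circle_le hL hr0.le hi le_rfl θ, norm_comp_circle_le hL hq0.le le_rfl hi θ]
  -- For `|k| ≥ n` the first term is `(1 + r ^ (-2|k|)) * c k` and the second removes the surplus,
  -- leaving `e k = c k`.
  let e : ℤ → ℂ := fun k => (tailWeight r⁻¹ n k : ℂ) * circleCoeff h k -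
    (tailWeight (r⁻¹ ^ 2) n k : ℂ) * c k
  refine ⟨fun k => c k - e k, fun θ => ?_⟩
  obtain ⟨U, hU, hUB⟩ := exists_hasSum_tailWeight hq0 hq1 (hc₁.add hc₂) hhB n θ
  obtain ⟨V, hV, hVB⟩ := exists_hasSum_tailWeight (q := r⁻¹ ^ 2) (by positivity)
    (pow_lt_one₀ hq0.le hq1 (by norm_num)) hc₀ hB₀ n θ
  have hsum := (hasSum_circleCoeff hr hd hL θ).sub (hU.sub hV)
  have hfin : HasSum (fun k : ℤ => (c k - e k) * exp (k * θ * I))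
      (∑ k ∈ Finset.Ioo (-(n : ℤ)) n, (c k - e k) * exp (k * θ * I)) := by
    refine hasSum_sum_of_ne_finset_zero fun k hk => ?_
    have hk' : n ≤ k.natAbs := by
      rw [Finset.mem_Ioo] at hk
      omega
    have hpow : ((r : ℂ) ^ k + ((r⁻¹ : ℝ) : ℂ) ^ k) =
        (((r⁻¹ ^ k.natAbs)⁻¹ + r⁻¹ ^ k.natAbs : ℝ) : ℂ) := by
      have hreal : r ^ k + r⁻¹ ^ k = (r⁻¹ ^ k.natAbs)⁻¹ + r⁻¹ ^ k.natAbs := by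
        rcases le_total 0 k with hk | hk
        · obtain ⟨m, rfl⟩ := Int.eq_ofNat_of_zero_le hk
          simp
        · obtain ⟨m, hm⟩ := Int.eq_ofNat_of_zero_le (neg_nonneg.mpr hk)
          obtain rfl : k = -(m : ℤ) := by omega
          simp [add_comm]
      rw [← hreal]
      push_cast
      ring
    have he : e k = c k := by
      change (tailWeight r⁻¹ n k : ℂ) * circleCoeff h k - (tailWeight (r⁻¹ ^ 2) n k : ℂ) * c k = _
      rw [hhc, tailWeight_eq hq0 hk', tailWeight_eq (by positivity) hk', hpow]
      have hne : ((r⁻¹ ^ k.natAbs : ℝ) : ℂ) ≠ 0 := ofReal_ne_zero.mpr (by positivity)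
      rw [← pow_mul, mul_comm 2, pow_mul, ofReal_pow _ 2, ofReal_add, ofReal_inv]
      generalize ((r⁻¹ ^ k.natAbs : ℝ) : ℂ) = y at hne
      field_simp
      ring
    rw [he, sub_self, zero_mul]
  have hUV : g (exp (θ * I)) - (U - V) =
      ∑ k ∈ Finset.Ioo (-(n : ℤ)) n, (c k - e k) * exp (k * θ * I) := by
    refine hsum.unique (hasSum_of_forall_eq (fun k => ?_) hfin)
    change c k * _ - (_ * circleCoeff h k * _ - _ * c k * _) = (c k - e k) * _
    simp only [e]
    ring
  rw [← hUV, sub_sub_cancel]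
  have hpow : (r⁻¹ ^ 2) ^ n ≤ r⁻¹ ^ n := by
    refine pow_le_pow_left₀ (by positivity) ?_ n
    nlinarith
  calc ‖U - V‖ ≤ ‖U‖ + ‖V‖ := norm_sub_le _ _
    _ ≤ 2 * r⁻¹ ^ n * (2 * L) + 2 * r⁻¹ ^ n * L := by
      refine add_le_add hUB (hVB.trans ?_)
      gcongr
    _ = _ := by ring

end Annulus

/-! ### From trigonometric to algebraic polynomials. -/

open Polynomial in
/-- A function that extends analytically to the region bounded by a Bernstein ellipse is
approximated on `[-1, 1]` by polynomials at a geometric rate. -/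
theorem exists_polynomial_approx {r L : ℝ} (hr : 1 < r) {F : ℂ → ℂ}
    (hF : DiffContOnCl ℂ F (bernsteinRegion (r ^ 2)))
    (hL : ∀ θ ∈ Set.Icc (0 : ℝ) (2 * Real.pi), ‖F (bernsteinPoint (r ^ 2) θ)‖ ≤ L)
    {f : ℝ → ℝ} (hf : ∀ t ∈ Set.Icc (-1 : ℝ) 1, F (t : ℂ) = (f t : ℂ)) (n : ℕ) :
    ∃ p : ℝ[X], p.degree < n ∧
      ∀ t ∈ Set.Icc (-1 : ℝ) 1, |f t - p.eval t| ≤ 6 * L * r⁻¹ ^ n := by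
  have hρ : 1 < r ^ 2 := one_lt_pow₀ hr (by norm_num)
  obtain ⟨d, hd⟩ := exists_trigPoly_approx (g := fun w => F (joukowski w)) (L := L) hr
    (fun w h1 h2 => by
      have hw : w ≠ 0 := by
        have : 0 < r⁻¹ := by positivity
        exact norm_pos_iff.mp (this.trans_le h1)
      refine DifferentiableAt.comp w (hF.differentiableAt (isOpen_bernsteinRegion _)
        (joukowski_mem_bernsteinRegion hr h1 h2)) ?_
      exact ((differentiableAt_id.add (differentiableAt_inv hw)).div_const 2))
    (fun w h1 h2 => norm_le_of_mem_bernsteinRegion hρ hF hL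
      (joukowski_mem_bernsteinRegion hr h1 h2)) n
  -- Averaging over `θ` and `-θ` turns exponentials into cosines, that is, Chebyshev polynomials in
  -- `cos θ`. Since `f` is real, only real parts are kept.
  refine ⟨∑ k ∈ Finset.Ioo (-(n : ℤ)) n, C (d k).re * Chebyshev.T ℝ k, ?_, fun t ht => ?_⟩
  · refine mem_degreeLT.mp (Submodule.sum_mem _ fun k hk => mem_degreeLT.mpr ?_)
    rw [← smul_eq_C_mul]
    refine lt_of_le_of_lt (degree_smul_le _ _) ?_
    rw [Chebyshev.degree_T]
    rw [Finset.mem_Ioo] at hk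
    exact_mod_cast (by omega : k.natAbs < n)
  · obtain ⟨θ, rfl⟩ : ∃ θ, Real.cos θ = t := ⟨Real.arccos t, Real.cos_arccos ht.1 ht.2⟩
    have hJ : ∀ x : ℝ, joukowski (exp (x * I)) = ((Real.cos x : ℝ) : ℂ) := by
      intro x
      rw [joukowski, ← exp_neg, ofReal_cos, Complex.cos, neg_mul]
    have h1 := hd θ
    have h2 := hd (-θ)
    rw [hJ] at h1 h2
    rw [Real.cos_neg] at h2
    rw [hf _ ht] at h1 h2
    have hev : ((∑ k ∈ Finset.Ioo (-(n : ℤ)) n, d k * (Real.cos (k * θ) : ℂ))).re =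
        (∑ k ∈ Finset.Ioo (-(n : ℤ)) n, C (d k).re * Chebyshev.T ℝ k).eval (Real.cos θ) := by
      rw [re_sum, eval_finsetSum]
      refine Finset.sum_congr rfl fun k _ => ?_
      rw [re_mul_ofReal, eval_C_mul, Chebyshev.T_real_cos]
    have havg : (f (Real.cos θ) : ℂ) - ∑ k ∈ Finset.Ioo (-(n : ℤ)) n, d k * (Real.cos (k * θ) : ℂ) =
        (((f (Real.cos θ) : ℂ) - ∑ k ∈ Finset.Ioo (-(n : ℤ)) n, d k * exp (k * θ * I)) +
        ((f (Real.cos θ) : ℂ) - ∑ k ∈ Finset.Ioo (-(n : ℤ)) n, d k * exp (k * (-θ : ℝ) * I))) / 2 := by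
      have : ∀ k : ℤ, d k * (Real.cos (k * θ) : ℂ) =
          (d k * exp (k * θ * I) + d k * exp (k * (-θ : ℝ) * I)) / 2 := by
        intro k
        rw [ofReal_cos, Complex.cos]
        push_cast
        rw [show -((k : ℂ) * θ) * I = k * -θ * I by ring]
        ring
      simp only [this]
      rw [← Finset.sum_div, Finset.sum_add_distrib]
      ring
    rw [← hev, ← ofReal_re (f (Real.cos θ)), ← sub_re]
    refine (abs_re_le_norm _).trans ?_
    rw [havg, norm_div, Complex.norm_ofNat, div_le_iff₀ two_pos]
    refine (norm_add_le _ _).trans ?_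
    linarith

end ExpCone

/-! ### The threshold for `N` and the two inclusions. -/

namespace ExpCone

theorem div_mem_ratioRange {M a b : ℝ} (hM : 1 < M) (ha : a ∈ Set.Icc (1 / M) M)
    (hb : b ∈ Set.Icc (1 / M) M) : a / b ∈ ratioRange M := by
  have hM0 : 0 < M := by linarith
  have hpos : 0 < 1 / M := by positivity
  have hb0 : 0 < b := hpos.trans_le hb.1
  have ha0 : 0 < a := hpos.trans_le ha.1
  constructor
  · calc 1 / M ^ 2 = (1 / M) / M := by field_simp
      _ ≤ a / b := div_le_div₀ ha0.le ha.1 hb0 hb.2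
  · calc a / b ≤ M / (1 / M) := div_le_div₀ hM0.le ha.2 hpos hb.1
      _ = M ^ 2 := by field_simp

/-- Bernoulli's inequality with exponent 24 turns the constant factor into a multiple of the
logarithm. -/
theorem le_mul_pow_of_logb_le {ρ L ε : ℝ} (hρ : 1 < ρ) (hL : 0 ≤ L) (hε : 0 < ε) {N : ℕ}
    (hN : 24 * (1 + Real.logb ρ (1 + L / ε)) ≤ N) : 24 * L ≤ ε * ρ ^ N := by
  have hx : 0 ≤ L / ε := by positivity
  have h1 : 1 + 24 * (L / ε) ≤ (1 + L / ε) ^ (24 : ℝ) :=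
    one_add_mul_self_le_rpow_one_add (by linarith) (by norm_num)
  have h2 : (1 + L / ε) ^ (24 : ℝ) ≤ ρ ^ N := by
    calc (1 + L / ε) ^ (24 : ℝ) = (ρ ^ Real.logb ρ (1 + L / ε)) ^ (24 : ℝ) := by
          rw [Real.rpow_logb (by linarith) hρ.ne' (by linarith)]
      _ = ρ ^ (Real.logb ρ (1 + L / ε) * 24) := by rw [← Real.rpow_mul (by linarith)]
      _ ≤ ρ ^ (N : ℝ) := Real.rpow_le_rpow_of_exponent_le hρ.le (by linarith)
      _ = ρ ^ N := Real.rpow_natCast _ _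
  calc 24 * L ≤ ε * (1 + 24 * (L / ε)) := by
        field_simp
        linarith
    _ ≤ ε * ρ ^ N := by gcongr; exact h1.trans h2

theorem HasBernsteinBound.nonneg {M : ℝ} {φ : ℝ → ℝ → ℝ} {ρ L : ℝ} (hM : 1 < M)
    (h : HasBernsteinBound (ratioRange M) φ ρ L) : 0 ≤ L := by
  have h1 : (1 : ℝ) ∈ Set.Icc (1 / M) M :=
    ⟨(div_le_one (by linarith)).mpr hM.le, hM.le⟩
  obtain ⟨F, -, -, hF⟩ := h (1 / 1) (div_mem_ratioRange hM h1 h1)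
  exact (norm_nonneg _).trans (hF 0 ⟨le_rfl, by positivity⟩)

/-- Gauss quadrature of a generating function approximates the logarithm. -/
theorem abs_log_add_sub_sum_le {M : ℝ} {φ : ℝ → ℝ → ℝ} {c ρ L ε : ℝ} (hM : 1 < M)
    (hφ : IsGeneratingFunction (ratioRange M) φ c) (hρ : 1 < ρ)
    (hB : HasBernsteinBound (ratioRange M) φ ρ L) (hε : 0 < ε) {N : ℕ} (hN0 : N ≠ 0)
    (hN : 24 * (1 + Real.logb ρ (1 + L / ε)) ≤ N) {t w : Fin N → ℝ}
    (h : IsGaussQuadrature N t w) {x : ℝ} (hx : x ∈ ratioRange M) :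
    |Real.log x + c - ∑ k, w k * φ (t k) x| ≤ ε := by
  obtain ⟨F, hF, hFφ, hFL⟩ := hB x hx
  have hρ0 : 0 < ρ := by linarith
  have hr : 1 < Real.sqrt ρ := by rwa [Real.lt_sqrt zero_le_one, one_pow]
  have hsq : Real.sqrt ρ ^ 2 = ρ := Real.sq_sqrt hρ0.le
  obtain ⟨p, hp, hpf⟩ := exists_polynomial_approx (r := Real.sqrt ρ) (L := L) hr (F := F)
    (by rwa [hsq]) (by rwa [hsq]) (f := fun s => φ s x) hFφ (2 * N)
  have h1 := h.abs_integral_sub_sum_le hN0 (hφ.integrable x hx) hp hpf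
  rw [hφ.integral_eq x hx] at h1
  refine h1.trans ?_
  have h2 : (Real.sqrt ρ)⁻¹ ^ (2 * N) = (ρ ^ N)⁻¹ := by
    rw [pow_mul, inv_pow, hsq, inv_pow]
  have h3 := le_mul_pow_of_logb_le hρ (hB.nonneg hM) hε hN
  have h4 : 0 < ρ ^ N := by positivity
  rw [h2]
  calc 4 * (6 * L * (ρ ^ N)⁻¹) = 24 * L / ρ ^ N := by ring
    _ ≤ ε := by rwa [div_le_iff₀ h4]

end ExpCone

theorem mainTheorem2 :
    ∃ C : ℝ, 0 < C ∧
      ∀ (M : ℝ) (φ : ℝ → ℝ → ℝ) (c ρ L ε : ℝ),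
        1 < M →
        ExpCone.IsGeneratingFunction (ExpCone.ratioRange M) φ c →
        1 < ρ →
        ExpCone.HasBernsteinBound (ExpCone.ratioRange M) φ ρ L →
        0 < ε →
        ∀ N : ℕ, C * (1 + Real.logb ρ (1 + L / ε)) ≤ N →
          (∃ t w : Fin N → ℝ, ExpCone.IsGaussQuadrature N t w) ∧
          ∀ t w : Fin N → ℝ, ExpCone.IsGaussQuadrature N t w →
            ExpCone.IsSOCRepresentable (ExpCone.Ksc M φ c t w) ∧
            ExpCone.Kexp M (-ε) ⊆ ExpCone.Ksc M φ c t w ∧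
            ExpCone.Ksc M φ c t w ⊆ ExpCone.Kexp M ε := by
  -- `24 = 4 * 6`: quadrature constant times approximation constant.
  refine ⟨24, by norm_num, fun M φ c ρ L ε hM hφ hρ hB hε N hN => ?_⟩
  refine ⟨ExpCone.exists_isGaussQuadrature N, fun t w h => ⟨?_, ?_, ?_⟩⟩
  · exact ExpCone.isSOCRepresentable_Ksc (by linarith) fun k => hφ.soc _ (h.node_mem k)
  all_goals
    have hN0 : N ≠ 0 := by
      rintro rfl
      have hx : 0 ≤ L / ε := div_nonneg (hB.nonneg hM) hε.le
      have := Real.logb_nonneg hρ (by linarith : 1 ≤ 1 + L / ε)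
      rw [Nat.cast_zero] at hN
      linarith
    have hM0 : 0 < 1 / M := by positivity
  · rintro x ⟨h0, h1, h2, h3⟩
    have hx1 : 0 < x 1 := hM0.trans_le h1.1
    have hD := ExpCone.div_mem_ratioRange hM h0 h1
    have herr := abs_le.mp (ExpCone.abs_log_add_sub_sum_le hM hφ hρ hB hε hN0 hN h hD)
    -- The largest `v k` that the hypographs allow.
    refine ⟨h0, h1, fun k => x 1 * φ (t k) (x 0 / x 1), ?_, fun k => ⟨hD, ?_⟩⟩
    · have h4 : ∑ k, w k * (x 1 * φ (t k) (x 0 / x 1)) =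
          x 1 * ∑ k, w k * φ (t k) (x 0 / x 1) := by
        rw [Finset.mul_sum]
        exact Finset.sum_congr rfl fun k _ => by ring
      have h5 : x 2 / x 1 + c ≤ ∑ k, w k * φ (t k) (x 0 / x 1) := by
        simp only at h3
        linarith [herr.2]
      rw [h4]
      calc x 2 + c * x 1 = x 1 * (x 2 / x 1 + c) := by field_simp
        _ ≤ _ := by gcongr
    · exact (mul_div_cancel_left₀ _ hx1.ne').le
  · rintro x ⟨h0, h1, v, hv, hk⟩
    have hx1 : 0 < x 1 := hM0.trans_le h1.1
    have hD := ExpCone.div_mem_ratioRange hM h0 h1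
    have herr := abs_le.mp (ExpCone.abs_log_add_sub_sum_le hM hφ hρ hB hε hN0 hN h hD)
    refine ⟨h0, h1, div_pos (hM0.trans_le h0.1) hx1, ?_⟩
    have h4 : ∑ k, w k * v k ≤ x 1 * ∑ k, w k * φ (t k) (x 0 / x 1) := by
      rw [Finset.mul_sum]
      refine Finset.sum_le_sum fun k _ => ?_
      have h5 : v k ≤ φ (t k) (x 0 / x 1) * x 1 := (div_le_iff₀ hx1).mp (hk k).2
      calc w k * v k ≤ w k * (φ (t k) (x 0 / x 1) * x 1) :=
            mul_le_mul_of_nonneg_left h5 (h.weight_nonneg k)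
        _ = _ := by ring
    have h6 : x 2 / x 1 + c ≤ ∑ k, w k * φ (t k) (x 0 / x 1) := by
      refine le_of_mul_le_mul_left ?_ hx1
      calc x 1 * (x 2 / x 1 + c) = x 2 + c * x 1 := by field_simp
        _ ≤ _ := hv.trans h4
    simp only
    linarith [herr.1]
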